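/- A convex polyhedron $P\subset\mathbb R^3$ (a bounded intersection of finitely many closed half-spaces, with nonempty interior) is called $k$-equiprojective if its orthogonal projection to the plane $v^\perp$ is a convex $k$-gon for every direction $v\neq 0$ that is not parallel to any (two-dimensional) face of $P$. Let $P$ be an arbitrary quadrilateral pyramid in $\mathbb R^3$: its base is a (strictly) convex quadrilateral $B_0B_1B_2B_3$, with the vertices listed in cyclic order and indices taken modulo $4$, and its apex $O$ does not lie in the plane of the base. The four lateral edges are partitioned into the two paths $B_0OB_2$ and $B_1OB_3$ of opposite edges; each path lies in a plane. Cut $P$ by the following five planes: - (top cut) a plane parallel to the base through a point of the lateral edge $OB_0$ different from its two ends; it cuts off the apex $O$; - (side cuts) for each $i\in\{0,1,2,3\}$, a plane through a point of the lateral edge $OB_i$, different from its two ends, parallel to the plane $B_{i+1}OB_{i+3}$ of the path that does not end at $B_i$; it cuts off the base vertex $B_i$. The cuts are made so that no two of them meet in $P$, that is, the plane sections of $P$ by the five cutting planes are pairwise disjoint. The part $P'$ of $P$ that remains (on the base side of the top cut, and on the apex side of every side cut) is called an equitruncated pyramid. Theorem. Every equitruncated pyramid $P'$ is $10$-equiprojective.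 -/

import Mathlib

open scoped InnerProductSpace

/-- Euclidean three-space. -/
abbrev Space3 : Type := EuclideanSpace ℝ (Fin 3)

/-- A (bounded, full-dimensional) convex polyhedron: a bounded intersection of finitely many
closed half-spaces, with nonempty interior. -/
def IsConvexPolyhedron (P : Set Space3) : Prop :=
  (∃ H : Finset (Space3 × ℝ), P = {x | ∀ h ∈ H, ⟪h.1, x⟫_ℝ ≤ h.2}) ∧
    Bornology.IsBounded P ∧ (interior P).Nonempty

/-- `F` is a (two-dimensional) face of `P`: the set where some supporting plane touches `P`, of
dimension two. -/
def IsFacet (P F : Set Space3) : Prop :=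
  IsExposed ℝ P F ∧ F.Nonempty ∧ Module.finrank ℝ (vectorSpan ℝ F) = 2

/-- The direction `v` is parallel to some face of `P`. -/
def IsParallelToFace (P : Set Space3) (v : Space3) : Prop :=
  ∃ F, IsFacet P F ∧ v ∈ vectorSpan ℝ F

/-- The shadow of `P` in direction `v`: its orthogonal projection to the plane `v^⊥`. -/
noncomputable def shadow (P : Set Space3) (v : Space3) : Set Space3 :=
  (ℝ ∙ v)ᗮ.starProjection '' P

/-- `S` is a convex `k`-gon (with its inside): it is two-dimensional and it is the convex hull of
`k` points, none of which lies in the convex hull of the others. -/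
def IsConvexPolygon (k : ℕ) (S : Set Space3) : Prop :=
  Module.finrank ℝ (vectorSpan ℝ S) = 2 ∧
    ∃ s : Finset Space3, s.card = k ∧ ConvexIndependent ℝ ((↑) : s → Space3) ∧
      S = convexHull ℝ (s : Set Space3)

/-- `P` is a `k`-equiprojective convex polyhedron: its shadow is a `k`-gon in every direction that
is not parallel to a face. -/
def IsEquiprojective (k : ℕ) (P : Set Space3) : Prop :=
  IsConvexPolyhedron P ∧
    ∀ v : Space3, v ≠ 0 → ¬ IsParallelToFace P v → IsConvexPolygon k (shadow P v)

/-- An arbitrary pyramid over a convex quadrilateral. The base vertices `base 0, …, base 3` are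
listed in cyclic order (indices modulo 4): no three of them are collinear and the two diagonals
cross, which makes them the consecutive vertices of a (planar) strictly convex quadrilateral. -/
structure QuadPyramid where
  apex : Space3
  base : Fin 4 → Space3
  base_not_collinear : ∀ i : Fin 4, ¬ Collinear ℝ {base i, base (i + 1), base (i + 2)}
  diagonals_cross : (openSegment ℝ (base 0) (base 2) ∩ openSegment ℝ (base 1) (base 3)).Nonempty
  apex_notMem : apex ∉ affineSpan ℝ (Set.range base)

namespace QuadPyramid

/-- The pyramid as a solid. -/
def solid (Q : QuadPyramid) : Set Space3 :=
  convexHull ℝ (insert Q.apex (Set.range Q.base))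

/-- The plane through `p` parallel to the base. -/
noncomputable def topPlane (Q : QuadPyramid) (p : Space3) : AffineSubspace ℝ Space3 :=
  AffineSubspace.mk' p (vectorSpan ℝ (Set.range Q.base))

/-- The four lateral edges form two paths of opposite edges,
`base 0 - apex - base 2` and `base 1 - apex - base 3`. The path that does not end at `base i` is
`base (i + 1) - apex - base (i + 3)`; this is the plane through `p` parallel to the plane of that
path. -/
noncomputable def sidePlane (Q : QuadPyramid) (i : Fin 4) (p : Space3) :
    AffineSubspace ℝ Space3 :=
  AffineSubspace.mk' p (vectorSpan ℝ {Q.base (i + 1), Q.apex, Q.base (i + 3)})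

/-- The cuts of a quadrilateral pyramid: a top cut through a point of a lateral edge, and for each
base vertex a side cut through a point of the lateral edge that ends there (each cutting point is
different from the ends of the edge). No two of the five cuts meet in the pyramid. -/
structure Cuts (Q : QuadPyramid) where
  top : Space3
  side : Fin 4 → Space3
  top_mem : top ∈ openSegment ℝ Q.apex (Q.base 0)
  side_mem : ∀ i, side i ∈ openSegment ℝ Q.apex (Q.base i)
  top_disjoint : ∀ i,
    Disjoint (Q.solid ∩ Q.topPlane top) (Q.solid ∩ Q.sidePlane i (side i))
  side_disjoint : ∀ i j, i ≠ j →
    Disjoint (Q.solid ∩ Q.sidePlane i (side i)) (Q.solid ∩ Q.sidePlane j (side j))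

/-- The equitruncated pyramid: the part of the pyramid that remains after all cuts. The top cut
keeps the side of the base, and each side cut keeps the side of the apex (`WSameSide` includes the
points of the cutting plane itself). -/
def Cuts.equitruncated {Q : QuadPyramid} (c : Q.Cuts) : Set Space3 :=
  {x ∈ Q.solid | (Q.topPlane c.top).WSameSide (Q.base 0) x ∧
    ∀ i, (Q.sidePlane i (c.side i)).WSameSide Q.apex x}

end QuadPyramid

/-!
The vertices of a polytope are determined by the sets of facets through them. If a direction `v` is
parallel to no facet, the corners of the shadow are exactly the images of the vertices that lie both
on a facet whose outer normal has positive inner product with `v` and on one for which it is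
negative, so they can be counted from the signs of the normals alone.

In an equitruncated pyramid the normals of opposite side cuts are negative multiples of each other,
and so are those of the top and the bottom. The normal of a lateral face is the sum of those of the
two adjacent side cuts and of the top, with suitable positive coefficients, which restricts its sign
further. Each of the remaining sign patterns leaves exactly ten of the sixteen vertices.
-/

open Filter Topology

section ExtremePoints

variable {E G : Type*} [AddCommGroup E] [Module ℝ E] [AddCommGroup G] [Module ℝ G]

theorem map_mem_extremePoints_image {K : Set E} (hK : Convex ℝ K) (T : E →ₗ[ℝ] G) {x : E}
    (hx : x ∈ K.extremePoints ℝ) (hfiber : ∀ y ∈ K, T y = T x → y = x) :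
    T x ∈ (T '' K).extremePoints ℝ := by
  refine ⟨Set.mem_image_of_mem T hx.1, ?_⟩
  rintro _ ⟨y, hy, rfl⟩ _ ⟨z, hz, rfl⟩ hyz
  obtain ⟨w, hw, hwx⟩ := (image_openSegment ℝ T.toAffineMap y z).symm ▸ hyz
  rw [hfiber w (hK.openSegment_subset hy hz hw) hwx] at hw
  rw [hx.2 hy hz hw]

theorem map_notMem_extremePoints_image [TopologicalSpace E] [ContinuousAdd E]
    [ContinuousSMul ℝ E] {K : Set E} {T : E →ₗ[ℝ] G} (hT : T ≠ 0) {x : E}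
    (hx : x ∈ interior K) : T x ∉ (T '' K).extremePoints ℝ := by
  intro hTx
  obtain ⟨u, hu⟩ := DFunLike.ne_iff.1 hT
  have eventually_mem (d : E) : ∀ᶠ ε : ℝ in 𝓝[>] 0, x + ε • d ∈ K := by
    have hcont : Continuous fun ε : ℝ => x + ε • d := by fun_prop
    refine (hcont.continuousAt.eventually ?_).filter_mono nhdsWithin_le_nhds
    simpa using mem_interior_iff_mem_nhds.1 hx
  obtain ⟨ε, ⟨hpos, hneg⟩, hε⟩ :=
    ((eventually_mem u).and (eventually_mem (-u))).and self_mem_nhdsWithin |>.exists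
  have hmid : T x ∈ openSegment ℝ (T (x + ε • u)) (T (x + ε • -u)) :=
    ⟨1 / 2, 1 / 2, by norm_num, by norm_num, by norm_num, by
      simp only [map_add, map_smul, map_neg]; module⟩
  have hfix := hTx.2 (Set.mem_image_of_mem T hpos) (Set.mem_image_of_mem T hneg) hmid
  rw [map_add, map_smul, add_eq_left] at hfix
  exact hu ((smul_eq_zero.1 hfix).resolve_left (ne_of_gt hε))

end ExtremePoints

/-- A system of inequalities `normal f x ≤ bound f`, each cutting out a closed half-space; the
half-spaces are labelled by the expected facets `f : F` of their intersection. -/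
structure HalfspaceSystem (F E : Type*) [AddCommGroup E] [Module ℝ E] [TopologicalSpace E] where
  normal : F → StrongDual ℝ E
  bound : F → ℝ

namespace HalfspaceSystem

variable {F E : Type*} [AddCommGroup E] [Module ℝ E] [TopologicalSpace E]
  (S : HalfspaceSystem F E) {x y z d v : E} {f : F}

/-- The intersection of the half-spaces. -/
def carrier : Set E := {x | ∀ f, S.normal f x ≤ S.bound f}

theorem carrier_eq_iInter : S.carrier = ⋂ f, {x | S.normal f x ≤ S.bound f} :=
  Set.ext fun x => by simp [carrier]

theorem convex_carrier : Convex ℝ S.carrier := by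
  rw [carrier_eq_iInter]
  exact convex_iInter fun f => convex_halfSpace_le (S.normal f).isLinear _

theorem isClosed_carrier : IsClosed S.carrier := by
  rw [carrier_eq_iInter]
  exact isClosed_iInter fun f => isClosed_le (S.normal f).continuous continuous_const

theorem mem_interior_carrier [Finite F] (hx : ∀ f, S.normal f x < S.bound f) :
    x ∈ interior S.carrier := by
  have hopen : IsOpen (⋂ f, {y | S.normal f y < S.bound f}) :=
    isOpen_iInter_of_finite fun f => isOpen_lt (S.normal f).continuous continuous_const
  exact interior_maximal (fun y hy f => (Set.mem_iInter.1 hy f).le) hopen (Set.mem_iInter.2 hx)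

variable {S} in
theorem eventually_normal_add_smul_lt (d : E) (hf : S.normal f x < S.bound f) :
    ∀ᶠ ε : ℝ in 𝓝[>] 0, S.normal f (x + ε • d) < S.bound f := by
  have hcont : Continuous fun ε : ℝ => S.normal f x + ε * S.normal f d := by fun_prop
  simp only [map_add, map_smul, smul_eq_mul]
  exact (hcont.continuousAt.eventually_lt continuousAt_const (by simpa using hf)).filter_mono
    nhdsWithin_le_nhds

variable [Fintype F]

open scoped Classical in
/-- The inequalities that hold with equality at `x`; for a point of the carrier, these are the
facets through `x`. -/
noncomputable def tight (x : E) : Finset F := {f | S.normal f x = S.bound f}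

open scoped Classical in
/-- The facets seen by an observer at infinity in direction `v`. -/
noncomputable def visible (v : E) : Finset F := {f | 0 < S.normal f v}

@[simp]
theorem mem_tight : f ∈ S.tight x ↔ S.normal f x = S.bound f := by
  simp only [tight, Finset.mem_filter, Finset.mem_univ, true_and]

@[simp]
theorem mem_visible : f ∈ S.visible v ↔ 0 < S.normal f v := by
  simp only [visible, Finset.mem_filter, Finset.mem_univ, true_and]

section FeasibleDirections

variable {S}

theorem normal_lt_bound (hx : x ∈ S.carrier) (hf : f ∉ S.tight x) : S.normal f x < S.bound f :=
  (hx f).lt_of_ne fun h => hf (S.mem_tight.2 h)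

theorem eventually_add_smul_mem_carrier (hx : x ∈ S.carrier)
    (hd : ∀ f ∈ S.tight x, S.normal f d ≤ 0) : ∀ᶠ ε : ℝ in 𝓝[>] 0, x + ε • d ∈ S.carrier := by
  refine eventually_all.2 fun f => ?_
  by_cases hf : f ∈ S.tight x
  · filter_upwards [self_mem_nhdsWithin] with ε hε
    rw [map_add, map_smul, S.mem_tight.1 hf, smul_eq_mul]
    linarith [mul_nonpos_of_nonneg_of_nonpos (le_of_lt hε) (hd f hf)]
  · exact (eventually_normal_add_smul_lt d (normal_lt_bound hx hf)).mono fun _ => le_of_lt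

theorem eventually_add_smul_mem_interior (hx : x ∈ S.carrier)
    (hd : ∀ f ∈ S.tight x, S.normal f d < 0) :
    ∀ᶠ ε : ℝ in 𝓝[>] 0, x + ε • d ∈ interior S.carrier := by
  refine (eventually_all.2 fun f => ?_).mono fun _ => S.mem_interior_carrier
  by_cases hf : f ∈ S.tight x
  · filter_upwards [self_mem_nhdsWithin] with ε hε
    rw [map_add, map_smul, S.mem_tight.1 hf, smul_eq_mul]
    linarith [mul_neg_of_pos_of_neg hε (hd f hf)]
  · exact eventually_normal_add_smul_lt d (normal_lt_bound hx hf)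

end FeasibleDirections

section TightSets

variable {S}

theorem mem_tight_iff_of_mem_openSegment (hx : x ∈ S.carrier) (hy : y ∈ S.carrier)
    (hz : z ∈ openSegment ℝ x y) : f ∈ S.tight z ↔ f ∈ S.tight x ∧ f ∈ S.tight y := by
  obtain ⟨a, b, ha, hb, hab, rfl⟩ := hz
  have hx' := mul_le_mul_of_nonneg_left (hx f) ha.le
  have hy' := mul_le_mul_of_nonneg_left (hy f) hb.le
  have hbound : a * S.bound f + b * S.bound f = S.bound f := by rw [← add_mul, hab, one_mul]
  simp only [mem_tight, map_add, map_smul, smul_eq_mul]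
  constructor
  · intro h
    exact ⟨mul_left_cancel₀ ha.ne' (by linarith), mul_left_cancel₀ hb.ne' (by linarith)⟩
  · rintro ⟨h, h'⟩
    rw [h, h', hbound]

theorem exists_mem_carrier_forall_mem_tight_iff {ι : Type*} {s : Finset ι} (hs : s.Nonempty)
    {p : ι → E} (hp : ∀ i ∈ s, p i ∈ S.carrier) :
    ∃ z ∈ S.carrier, ∀ f, f ∈ S.tight z ↔ ∀ i ∈ s, f ∈ S.tight (p i) := by
  induction hs using Finset.Nonempty.cons_induction with
  | singleton i => exact ⟨p i, hp i (Finset.mem_singleton_self i), by simp⟩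
  | cons i s _ _ ih =>
    simp only [Finset.forall_mem_cons] at hp ⊢
    obtain ⟨y, hy, hys⟩ := ih hp.2
    have hmid : midpoint ℝ (p i) y ∈ openSegment ℝ (p i) y :=
      ⟨1 / 2, 1 / 2, by norm_num, by norm_num, by norm_num, by
        rw [midpoint_eq_smul_add, invOf_eq_inv]; module⟩
    refine ⟨_, S.convex_carrier.openSegment_subset hp.1 hy hmid, fun f => ?_⟩
    rw [mem_tight_iff_of_mem_openSegment hp.1 hy hmid, hys]

theorem eq_zero_of_mem_extremePoints (hx : x ∈ S.carrier.extremePoints ℝ)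
    (hd : ∀ f ∈ S.tight x, S.normal f d = 0) : d = 0 := by
  obtain ⟨ε, ⟨hpos, hneg⟩, hε⟩ :=
    ((eventually_add_smul_mem_carrier hx.1 fun f hf => (hd f hf).le).and
      (eventually_add_smul_mem_carrier (d := -d) hx.1 fun f hf => by simp [hd f hf])).and
      self_mem_nhdsWithin |>.exists
  have hmid : x ∈ openSegment ℝ (x + ε • d) (x + ε • -d) :=
    ⟨1 / 2, 1 / 2, by norm_num, by norm_num, by norm_num, by module⟩
  have hfix := hx.2 hpos hneg hmid
  rw [add_eq_left] at hfix
  exact (smul_eq_zero.1 hfix).resolve_left (ne_of_gt hε)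

theorem finrank_le_card_tight (hx : x ∈ S.carrier.extremePoints ℝ) :
    Module.finrank ℝ E ≤ (S.tight x).card := by
  let evalTight : E →ₗ[ℝ] S.tight x → ℝ := LinearMap.pi fun f => (S.normal f).toLinearMap
  have hinj : Function.Injective evalTight := by
    rw [injective_iff_map_eq_zero]
    exact fun d hd => eq_zero_of_mem_extremePoints hx fun f hf => congrFun hd ⟨f, hf⟩
  simpa only [Module.finrank_fintype_fun_eq_card, Fintype.card_coe] using
    LinearMap.finrank_le_finrank_of_injective hinj

theorem eq_of_tight_subset (hx : x ∈ S.carrier.extremePoints ℝ) (h : S.tight x ⊆ S.tight y) :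
    y = x :=
  sub_eq_zero.1 <| eq_zero_of_mem_extremePoints hx fun f hf => by
    rw [map_sub, S.mem_tight.1 hf, S.mem_tight.1 (h hf), sub_self]

theorem tight_injOn_extremePoints : Set.InjOn S.tight (S.carrier.extremePoints ℝ) :=
  fun _ _ _ hy h => eq_of_tight_subset hy h.ge

omit [Fintype F] in
theorem finite_extremePoints [Finite F] : (S.carrier.extremePoints ℝ).Finite :=
  have := Fintype.ofFinite F
  Set.Finite.of_finite_image (Set.toFinite _) tight_injOn_extremePoints

theorem exists_mem_extremePoints_tight_subset [T2Space E] [IsTopologicalAddGroup E]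
    [ContinuousSMul ℝ E] [LocallyConvexSpace ℝ E] (hS : IsCompact S.carrier)
    (hx : x ∈ S.carrier) : ∃ y ∈ S.carrier.extremePoints ℝ, S.tight x ⊆ S.tight y := by
  let face : Set E := S.carrier ∩ ⋂ f ∈ S.tight x, {y | S.normal f y = S.bound f}
  have mem_face (y : E) : y ∈ face ↔ y ∈ S.carrier ∧ S.tight x ⊆ S.tight y := by
    simp [face, Finset.subset_iff]
  have hcompact : IsCompact face := hS.inter_right <| isClosed_biInter fun f _ =>
    isClosed_eq (S.normal f).continuous continuous_const
  have hextreme : IsExtreme ℝ S.carrier face := by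
    refine ⟨Set.inter_subset_left, fun a ha b hb c hc hab => (mem_face a).2 ⟨ha, fun f hf => ?_⟩⟩
    exact ((mem_tight_iff_of_mem_openSegment ha hb hab).1 (((mem_face c).1 hc).2 hf)).1
  obtain ⟨y, hy⟩ := hcompact.extremePoints_nonempty ⟨x, (mem_face x).2 ⟨hx, subset_rfl⟩⟩
  exact ⟨y, hextreme.extremePoints_subset_extremePoints hy, ((mem_face y).1 hy.1).2⟩

end TightSets

section Faces

/-- The part of the carrier on the boundary hyperplane of the half-space `f`. -/
def face (f : F) : Set E := {x ∈ S.carrier | f ∈ S.tight x}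

theorem isExposed_face (f : F) : IsExposed ℝ S.carrier (S.face f) := by
  rintro ⟨z, hz, hzf⟩
  rw [mem_tight] at hzf
  refine ⟨S.normal f, Set.ext fun x => and_congr_right fun hx => ?_⟩
  rw [mem_tight]
  exact ⟨fun h y hy => h ▸ hy f, fun h => le_antisymm (hx f) (hzf ▸ h z hz)⟩

variable {S}

theorem vectorSpan_face (hz : z ∈ S.carrier) (hzf : S.tight z = {f}) :
    vectorSpan ℝ (S.face f) = (S.normal f).ker := by
  apply le_antisymm
  · refine Submodule.span_le.2 ?_
    rintro _ ⟨x, hx, y, hy, rfl⟩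
    simp [S.mem_tight.1 hx.2, S.mem_tight.1 hy.2]
  · intro d hd
    have hd' : S.normal f d = 0 := hd
    have hfz : f ∈ S.tight z := by simp [hzf]
    obtain ⟨ε, hmem, hε⟩ := ((eventually_add_smul_mem_carrier (d := d) hz
      (by simp [hzf, hd'])).and self_mem_nhdsWithin).exists
    have hface : z + ε • d ∈ S.face f := ⟨hmem, by simpa [hd'] using hfz⟩
    have := vsub_mem_vectorSpan ℝ hface (show z ∈ S.face f from ⟨hz, hfz⟩)
    rw [vsub_eq_sub, add_sub_cancel_left] at this
    exact (Submodule.smul_mem_iff _ (ne_of_gt hε)).1 this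

end Faces

section Silhouette

/-- The vertices that lie both on a facet visible from `v` and on an invisible one; their
projections along `v` are the corners of the shadow. -/
def silhouette (v : E) : Set E :=
  {x ∈ S.carrier.extremePoints ℝ |
    (∃ f ∈ S.tight x, f ∈ S.visible v) ∧ ∃ f ∈ S.tight x, f ∉ S.visible v}

variable {S}

theorem eq_zero_of_add_smul_mem_carrier (hv : ∀ f, S.normal f v ≠ 0) (hx : x ∈ S.silhouette v)
    {t : ℝ} (ht : x + t • v ∈ S.carrier) : t = 0 := by
  obtain ⟨-, ⟨f, hf, hfv⟩, g, hg, hgv⟩ := hx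
  simp only [mem_tight, mem_visible, not_lt] at hf hfv hg hgv
  have hle_f := ht f
  have hle_g := ht g
  rw [map_add, map_smul, smul_eq_mul] at hle_f hle_g
  have hgv' := hgv.lt_of_ne (hv g)
  exact le_antisymm (nonpos_of_mul_nonpos_left (by linarith) hfv)
    (nonneg_of_mul_nonpos_left (by linarith) hgv')

theorem exists_smul_forall_mem_tight_neg (hv : ∀ f, S.normal f v ≠ 0)
    (hx : x ∈ S.carrier.extremePoints ℝ) (hxv : x ∉ S.silhouette v) :
    ∃ σ : ℝ, ∀ f ∈ S.tight x, S.normal f (σ • v) < 0 := by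
  by_cases hvisible : ∃ f ∈ S.tight x, f ∈ S.visible v
  · refine ⟨-1, fun f hf => ?_⟩
    have : f ∈ S.visible v := by_contra fun hfv => hxv ⟨hx, hvisible, f, hf, hfv⟩
    simpa using this
  · push Not at hvisible
    exact ⟨1, fun f hf => by simpa using (hv f).lt_of_le (by simpa using hvisible f hf)⟩

variable {G : Type*} [AddCommGroup G] [Module ℝ G] [TopologicalSpace G] {T : E →L[ℝ] G}

theorem eq_of_mem_silhouette_of_map_eq (hv : ∀ f, S.normal f v ≠ 0) (hker : T.ker = ℝ ∙ v)
    (hx : x ∈ S.silhouette v) (hy : y ∈ S.carrier) (hxy : T y = T x) : y = x := by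
  have hmem : y - x ∈ ℝ ∙ v := by
    rw [← hker]
    simp [hxy]
  obtain ⟨t, ht⟩ := Submodule.mem_span_singleton.1 hmem
  obtain rfl : y = x + t • v := by rw [ht, add_sub_cancel]
  rw [eq_zero_of_add_smul_mem_carrier hv hx hy, zero_smul, add_zero]

theorem extremePoints_image_carrier [T2Space E] [IsTopologicalAddGroup E] [ContinuousSMul ℝ E]
    [LocallyConvexSpace ℝ E] [T1Space G] (hS : IsCompact S.carrier)
    (hv : ∀ f, S.normal f v ≠ 0) (hker : T.ker = ℝ ∙ v) (hT : T ≠ 0) :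
    (T '' S.carrier).extremePoints ℝ = T '' S.silhouette v := by
  apply Set.Subset.antisymm
  · intro p hp
    obtain ⟨x, hx, rfl⟩ := surjOn_extremePoints_image T.toContinuousAffineMap hS hp
    refine ⟨x, by_contra fun hxv => ?_, rfl⟩
    obtain ⟨σ, hσ⟩ := exists_smul_forall_mem_tight_neg hv hx hxv
    obtain ⟨ε, hε⟩ := (eventually_add_smul_mem_interior hx.1 hσ).exists
    have hTv : T v = 0 := by
      have : v ∈ T.ker := hker ▸ Submodule.mem_span_singleton_self v
      exact this
    have hnot := map_notMem_extremePoints_image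
      (T := T.toLinearMap) (fun h => hT (ContinuousLinearMap.coe_injective h)) hε
    apply hnot
    simpa [hTv] using hp
  · rintro _ ⟨x, hx, rfl⟩
    exact map_mem_extremePoints_image S.convex_carrier T.toLinearMap hx.1 fun y hy =>
      eq_of_mem_silhouette_of_map_eq hv hker hx hy

end Silhouette

end HalfspaceSystem

section Shadow

variable {P : Set Space3} {v : Space3}

theorem ker_starProjection_orthogonal_span_singleton (v : Space3) :
    ((ℝ ∙ v)ᗮ.starProjection).ker = ℝ ∙ v := by
  rw [Submodule.ker_starProjection, Submodule.orthogonal_orthogonal]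

theorem finrank_orthogonal_span_singleton_space3 (hv : v ≠ 0) :
    Module.finrank ℝ (ℝ ∙ v)ᗮ = 2 := by
  have : Fact (Module.finrank ℝ Space3 = 2 + 1) := ⟨by simp⟩
  exact Submodule.finrank_orthogonal_span_singleton hv

theorem finrank_vectorSpan_shadow (hP : Convex ℝ P) (hint : (interior P).Nonempty)
    (hv : v ≠ 0) : Module.finrank ℝ (vectorSpan ℝ (shadow P v)) = 2 := by
  have hspan : vectorSpan ℝ P = ⊤ := by
    rw [← direction_affineSpan, hP.interior_nonempty_iff_affineSpan_eq_top.1 hint,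
      AffineSubspace.direction_top]
  have hshadow : vectorSpan ℝ (shadow P v) = (ℝ ∙ v)ᗮ := by
    have hmap := AffineMap.map_vectorSpan (s := P)
      ((ℝ ∙ v)ᗮ.starProjection : Space3 →ₗ[ℝ] Space3).toAffineMap
    rw [hspan, Submodule.map_top] at hmap
    exact hmap.symm.trans (Submodule.range_starProjection _)
  rw [hshadow, finrank_orthogonal_span_singleton_space3 hv]

theorem isConvexPolygon_ncard_extremePoints {S : Set Space3} (hcompact : IsCompact S)
    (hconvex : Convex ℝ S) (hfinite : (S.extremePoints ℝ).Finite)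
    (hdim : Module.finrank ℝ (vectorSpan ℝ S) = 2) :
    IsConvexPolygon (S.extremePoints ℝ).ncard S := by
  refine ⟨hdim, hfinite.toFinset, (Set.ncard_eq_toFinset_card _ hfinite).symm, ?_, ?_⟩
  · have hindep := hconvex.convexIndependent_extremePoints
    rwa [← hfinite.coe_toFinset] at hindep
  · rw [hfinite.coe_toFinset, ← (hfinite.isCompact_convexHull ℝ).isClosed.closure_eq]
    exact (closure_convexHull_extremePoints hcompact hconvex).symm

end Shadow

namespace HalfspaceSystem

variable {F : Type*} {S : HalfspaceSystem F Space3} {v : Space3} {f : F}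

theorem isConvexPolyhedron_carrier [Finite F] (hbounded : Bornology.IsBounded S.carrier)
    (hint : (interior S.carrier).Nonempty) : IsConvexPolyhedron S.carrier := by
  classical
  have := Fintype.ofFinite F
  refine ⟨⟨Finset.univ.image fun f =>
    ((InnerProductSpace.toDual ℝ Space3).symm (S.normal f), S.bound f), ?_⟩, hbounded, hint⟩
  ext x
  simp [carrier]

variable [Fintype F]

theorem isFacet_face {z : Space3} (hz : z ∈ S.carrier) (hzf : S.tight z = {f})
    (hf : S.normal f ≠ 0) : IsFacet S.carrier (S.face f) := by
  refine ⟨S.isExposed_face f, ⟨z, hz, by simp [hzf]⟩, ?_⟩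
  have hker := Module.Dual.finrank_ker_add_one_of_ne_zero
    (f := (S.normal f).toLinearMap) fun h => hf (ContinuousLinearMap.coe_injective h)
  rw [vectorSpan_face hz hzf]
  simpa using hker

theorem isConvexPolygon_shadow (hcompact : IsCompact S.carrier)
    (hint : (interior S.carrier).Nonempty) (hv₀ : v ≠ 0) (hv : ∀ f, S.normal f v ≠ 0) :
    IsConvexPolygon (S.silhouette v).ncard (shadow S.carrier v) := by
  set T := (ℝ ∙ v)ᗮ.starProjection with hT
  have hker : T.ker = ℝ ∙ v := ker_starProjection_orthogonal_span_singleton v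
  have hT₀ : T ≠ 0 := by
    intro h
    have hrank := finrank_orthogonal_span_singleton_space3 hv₀
    rw [← Submodule.range_starProjection (ℝ ∙ v)ᗮ, ← hT, h] at hrank
    exact two_ne_zero (hrank.symm.trans (by simp [LinearMap.range_zero]))
  have hext : (shadow S.carrier v).extremePoints ℝ = T '' S.silhouette v :=
    extremePoints_image_carrier hcompact hv hker hT₀
  have hinj : Set.InjOn T (S.silhouette v) := fun x hx y hy hxy =>
    (eq_of_mem_silhouette_of_map_eq hv hker hx hy.1.1 hxy.symm).symm
  rw [← hinj.ncard_image, ← hext]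
  refine isConvexPolygon_ncard_extremePoints (hcompact.image T.continuous)
    (S.convex_carrier.linear_image T.toLinearMap) ?_
    (finrank_vectorSpan_shadow S.convex_carrier hint hv₀)
  rw [hext]
  exact (finite_extremePoints.subset fun x hx => hx.1).image T

section FacetsOfVertices

variable {ι : Type*} {facets : ι → Finset F}

theorem exists_mem_carrier_forall_mem_facets_iff
    (hfacets : S.tight '' S.carrier.extremePoints ℝ = Set.range facets) {s : Finset ι}
    (hs : s.Nonempty) : ∃ z ∈ S.carrier, ∀ f, f ∈ S.tight z ↔ ∀ i ∈ s, f ∈ facets i := by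
  choose vertex hvertex htight using fun i => hfacets.ge ⟨i, rfl⟩
  simpa only [htight] using
    exists_mem_carrier_forall_mem_tight_iff hs fun i _ => (hvertex i).1

variable [Nontrivial F]
  (hfacets : S.tight '' S.carrier.extremePoints ℝ = Set.range facets)
  (hseparate : ∀ f g, g ≠ f → ∃ i, f ∈ facets i ∧ g ∉ facets i)

include hfacets hseparate

theorem normal_ne_zero (f : F) : S.normal f ≠ 0 := by
  obtain ⟨g, hgf⟩ := exists_ne f
  obtain ⟨i, hi, -⟩ := hseparate f g hgf
  obtain ⟨j, -, hj⟩ := hseparate g f hgf.symm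
  obtain ⟨x, -, hxi⟩ := hfacets.ge ⟨i, rfl⟩
  obtain ⟨y, hy, hyj⟩ := hfacets.ge ⟨j, rfl⟩
  have hlt := normal_lt_bound hy.1 (hyj ▸ hj)
  rw [← S.mem_tight.1 (hxi ▸ hi)] at hlt
  intro h
  simp [h] at hlt

variable [Finite ι]

theorem interior_carrier_nonempty : (interior S.carrier).Nonempty := by
  have := Fintype.ofFinite ι
  obtain ⟨f, g, hfg⟩ := exists_pair_ne F
  obtain ⟨i, -⟩ := hseparate f g hfg.symm
  obtain ⟨z, hz, hzf⟩ :=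
    exists_mem_carrier_forall_mem_facets_iff hfacets (s := Finset.univ) ⟨i, Finset.mem_univ i⟩
  refine ⟨z, S.mem_interior_carrier fun f => normal_lt_bound hz fun hf => ?_⟩
  obtain ⟨g, hgf⟩ := exists_ne f
  obtain ⟨j, -, hj⟩ := hseparate g f hgf.symm
  exact hj ((hzf f).1 hf j (Finset.mem_univ j))

theorem exists_tight_eq_singleton (f : F) : ∃ z ∈ S.carrier, S.tight z = {f} := by
  classical
  have := Fintype.ofFinite ι
  obtain ⟨g, hgf⟩ := exists_ne f
  obtain ⟨i, hi, -⟩ := hseparate f g hgf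
  obtain ⟨z, hz, hzf⟩ := exists_mem_carrier_forall_mem_facets_iff hfacets
    (s := {i | f ∈ facets i}) ⟨i, by simpa using hi⟩
  simp only [Finset.mem_filter, Finset.mem_univ, true_and] at hzf
  refine ⟨z, hz, Finset.ext fun g => ?_⟩
  rw [hzf, Finset.mem_singleton]
  refine ⟨fun h => by_contra fun hg => ?_, fun h i hi => h ▸ hi⟩
  obtain ⟨j, hfj, hgj⟩ := hseparate f g hg
  exact hgj (h j hfj)

theorem isParallelToFace_of_normal_eq_zero (hv : S.normal f v = 0) :
    IsParallelToFace S.carrier v := by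
  obtain ⟨z, hz, hzf⟩ := exists_tight_eq_singleton hfacets hseparate f
  refine ⟨S.face f, isFacet_face hz hzf (normal_ne_zero hfacets hseparate f), ?_⟩
  rwa [vectorSpan_face hz hzf]

theorem isEquiprojective_carrier (hbounded : Bornology.IsBounded S.carrier)
    (hinjective : Function.Injective facets) {k : ℕ}
    (hcount : ∀ v, (∀ f, S.normal f v ≠ 0) →
      {i | (∃ f ∈ facets i, f ∈ S.visible v) ∧ ∃ f ∈ facets i, f ∉ S.visible v}.ncard = k) :
    IsEquiprojective k S.carrier := by
  have hint := interior_carrier_nonempty hfacets hseparate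
  have hcompact := Metric.isCompact_of_isClosed_isBounded S.isClosed_carrier hbounded
  refine ⟨isConvexPolyhedron_carrier hbounded hint, fun v hv₀ hv => ?_⟩
  have hnormal (f : F) : S.normal f v ≠ 0 :=
    fun h => hv (isParallelToFace_of_normal_eq_zero hfacets hseparate h)
  have htight : S.tight '' S.silhouette v =
      facets '' {i | (∃ f ∈ facets i, f ∈ S.visible v) ∧ ∃ f ∈ facets i, f ∉ S.visible v} := by
    ext T
    constructor
    · rintro ⟨x, ⟨hx, hxv⟩, rfl⟩
      obtain ⟨i, hi⟩ := hfacets.le ⟨x, hx, rfl⟩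
      exact ⟨i, by rwa [← hi] at hxv, hi⟩
    · rintro ⟨i, hiv, rfl⟩
      obtain ⟨x, hx, hxi⟩ := hfacets.ge ⟨i, rfl⟩
      exact ⟨x, ⟨hx, by rwa [hxi]⟩, hxi⟩
  have hncard : (S.silhouette v).ncard = k := by
    rw [← hcount v hnormal, ← hinjective.injOn.ncard_image, ← htight,
      (tight_injOn_extremePoints.mono fun x hx => hx.1).ncard_image]
  exact hncard ▸ isConvexPolygon_shadow hcompact hint hv₀ hnormal

end FacetsOfVertices

end HalfspaceSystem

/-- The facets of an equitruncated pyramid: the top cut, the rest of the base, the side cut at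
`base i`, and the rest of the lateral face through `base i` and `base (i + 1)`. -/
inductive EquitruncatedFacet
  | top
  | bottom
  | cut (i : Fin 4)
  | lateral (i : Fin 4)
  deriving DecidableEq, Fintype

/-- The vertices of an equitruncated pyramid: two on each lateral edge (`upper i` on the top cut
and `lower i` on the side cut), and two on each base edge from `base i` to `base (i + 1)`, of which
`first i` is the one closer to `base i`. -/
inductive EquitruncatedVertex
  | upper (i : Fin 4)
  | lower (i : Fin 4)
  | first (i : Fin 4)
  | second (i : Fin 4)
  deriving DecidableEq, Fintype

namespace EquitruncatedFacet

instance : Nontrivial EquitruncatedFacet := ⟨top, bottom, by decide⟩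

end EquitruncatedFacet

namespace EquitruncatedVertex

open EquitruncatedFacet

/-- The facets that meet at a vertex. -/
def facets : EquitruncatedVertex → Finset EquitruncatedFacet
  | upper i => {top, lateral i, lateral (i + 3)}
  | lower i => {cut i, lateral i, lateral (i + 3)}
  | first i => {bottom, cut i, lateral i}
  | second i => {bottom, cut (i + 1), lateral i}

theorem facets_injective : Function.Injective facets := by
  unfold Function.Injective
  decide +kernel

theorem card_facets (v : EquitruncatedVertex) : v.facets.card = 3 := by
  revert v
  decide

theorem exists_mem_facets_notMem_facets (f g : EquitruncatedFacet) (hgf : g ≠ f) :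
    ∃ v, f ∈ facets v ∧ g ∉ facets v := by
  revert f g
  decide

theorem exists_facets_eq {T : Finset EquitruncatedFacet} (hT : 3 ≤ T.card)
    (bottom_of_top : top ∈ T → bottom ∉ T)
    (cut_of_top : ∀ i, top ∈ T → cut i ∉ T)
    (cut_of_cut : ∀ i, cut i ∈ T → cut (i + 1) ∉ T ∧ cut (i + 2) ∉ T)
    (lateral_of_cut : ∀ i, cut i ∈ T → lateral (i + 1) ∉ T ∧ lateral (i + 2) ∉ T)
    (lateral_of_lateral : ∀ i, lateral i ∈ T → lateral (i + 2) ∉ T)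
    (lateral_of_bottom : ∀ i, bottom ∈ T → lateral i ∈ T → lateral (i + 1) ∉ T) :
    ∃ v, facets v = T := by
  revert T
  decide +kernel

set_option synthInstance.maxSize 2000 in
theorem ncard_setOf_facets_mixed {V : Finset EquitruncatedFacet}
    (bottom_iff : bottom ∈ V ↔ top ∉ V)
    (cut_iff : ∀ i, cut (i + 2) ∈ V ↔ cut i ∉ V)
    (lateral_of_cut : ∀ i, cut i ∈ V →
      (lateral (i + 1) ∈ V → lateral i ∈ V) ∧ (lateral (i + 2) ∈ V → lateral (i + 3) ∈ V))
    (lateral_of_top : ∀ i, top ∈ V → cut i ∈ V → cut (i + 1) ∈ V → lateral i ∈ V)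
    (cut_of_bottom : ∀ i, bottom ∈ V → lateral i ∈ V → cut i ∈ V ∨ cut (i + 1) ∈ V) :
    {v | (∃ f ∈ facets v, f ∈ V) ∧ ∃ f ∈ facets v, f ∉ V}.ncard = 10 := by
  rw [Set.ncard_eq_toFinset_card', Set.toFinset_ofPred]
  revert V
  decide +kernel

end EquitruncatedVertex

section AffineGeometry

theorem smul_add_smul_sub_of_add_eq_one {k E : Type*} [Ring k] [AddCommGroup E] [Module k E]
    {a b : k} (hab : a + b = 1) (x y p : E) :
    a • x + b • y - p = a • (x - p) + b • (y - p) := by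
  rw [smul_sub, smul_sub, sub_add_sub_comm, ← add_smul, hab, one_smul]

theorem linearIndependent_vsub_of_notMem_affineSpan {k V P ι : Type*} [DivisionRing k]
    [AddCommGroup V] [Module k V] [AddTorsor V P] {p : ι → P} (hp : AffineIndependent k p) {q : P}
    (hq : q ∉ affineSpan k (Set.range p)) : LinearIndependent k fun i => p i -ᵥ q := by
  rw [linearIndependent_iff']
  intro s w hw
  by_cases hsum : ∑ i ∈ s, w i = 0
  · refine hp s w hsum ?_
    rwa [s.weightedVSub_eq_weightedVSubOfPoint_of_sum_eq_zero w p hsum q,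
      s.weightedVSubOfPoint_apply]
  · set c := (∑ i ∈ s, w i)⁻¹
    have hone : ∑ i ∈ s, c * w i = 1 := by rw [← Finset.mul_sum, inv_mul_cancel₀ hsum]
    have hmem := affineCombination_mem_affineSpan hone p
    rw [s.affineCombination_eq_weightedVSubOfPoint_vadd_of_sum_eq_one _ p hone q,
      s.weightedVSubOfPoint_apply] at hmem
    simp only [mul_smul, ← Finset.smul_sum, hw, smul_zero, zero_vadd] at hmem
    exact absurd hmem hq

theorem wSameSide_mk'_ker_iff {E : Type*} [AddCommGroup E] [Module ℝ E] (φ : E →ₗ[ℝ] ℝ)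
    {p a : E} (ha : φ p < φ a) (x : E) :
    (AffineSubspace.mk' p φ.ker).WSameSide a x ↔ φ p ≤ φ x := by
  have mem_iff (q : E) : q ∈ AffineSubspace.mk' p φ.ker ↔ φ q = φ p := by
    simp [AffineSubspace.mem_mk', sub_eq_zero]
  have hpos : 0 < φ a - φ p := sub_pos.2 ha
  constructor
  · rintro ⟨q, hq, r, hr, hray⟩
    have hray' := hray.map φ
    rw [vsub_eq_sub, vsub_eq_sub, map_sub, map_sub, (mem_iff q).1 hq, (mem_iff r).1 hr] at hray'
    obtain ⟨t, ht, heq⟩ := hray'.exists_nonneg_left hpos.ne'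
    have := mul_nonneg ht hpos.le
    rw [smul_eq_mul] at heq
    linarith
  · intro hx
    set t := (φ x - φ p) / (φ a - φ p)
    have ht : t * (φ a - φ p) = φ x - φ p := div_mul_cancel₀ _ hpos.ne'
    have hfoot : x - t • (a - p) ∈ AffineSubspace.mk' p φ.ker := by
      rw [mem_iff, map_sub, map_smul, map_sub, smul_eq_mul, ht, sub_sub_cancel]
    have := AffineSubspace.wSameSide_smul_vsub_vadd_right a ((mem_iff p).2 rfl) hfoot
      (div_nonneg (sub_nonneg.2 hx) hpos.le)
    simpa [t] using this

end AffineGeometry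

namespace QuadPyramid

variable {Q : QuadPyramid}

/-- The vector from the apex to `base i`. -/
def edge (Q : QuadPyramid) (i : Fin 4) : Space3 := Q.base i - Q.apex

theorem linearIndependent_edge (Q : QuadPyramid) :
    LinearIndependent ℝ fun j : Fin 3 => Q.edge j.castSucc := by
  have hbase : AffineIndependent ℝ ![Q.base 0, Q.base 1, Q.base 2] :=
    affineIndependent_iff_not_collinear_set.2 (Q.base_not_collinear 0)
  have hapex : Q.apex ∉ affineSpan ℝ (Set.range ![Q.base 0, Q.base 1, Q.base 2]) := by
    refine fun h => Q.apex_notMem (affineSpan_mono ℝ ?_ h)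
    rintro _ ⟨i, rfl⟩
    fin_cases i <;> exact ⟨_, rfl⟩
  have hedge : (fun j : Fin 3 => Q.edge j.castSucc) =
      fun j => ![Q.base 0, Q.base 1, Q.base 2] j -ᵥ Q.apex := by
    ext j : 1
    fin_cases j <;> rfl
  rw [hedge]
  exact linearIndependent_vsub_of_notMem_affineSpan hbase hapex

theorem exists_edge_coordinates (Q : QuadPyramid) : ∃ coord : Fin 3 → StrongDual ℝ Space3,
    (∀ j k : Fin 3, coord j (Q.edge k.castSucc) = if j = k then 1 else 0) ∧
      ∀ x, (∀ j, coord j x = 0) → x = 0 := by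
  set B := basisOfLinearIndependentOfCardEqFinrank Q.linearIndependent_edge (by simp) with hB
  refine ⟨fun j => (B.coord j).toContinuousLinearMap, fun j k => ?_, fun x hx => B.ext_elem ?_⟩
  · have hk : Q.edge k.castSucc = B k := by simp [hB]
    rw [hk, LinearMap.coe_toContinuousLinearMap', B.coord_apply, B.repr_self,
      Finsupp.single_apply]
    simp only [eq_comm]
  · simpa using hx

/-- Linear coordinates for the vectors from the apex of `Q`. The functional `height` is `1` on the
base, `side i` vanishes on the plane of the path that does not end at `base i` and is `1` at
`base i`, and `axis` is the vector from the apex to the crossing point of the diagonals, at which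
`base i` has weight `weight i` on its diagonal. -/
structure Frame (Q : QuadPyramid) where
  height : StrongDual ℝ Space3
  side : Fin 4 → StrongDual ℝ Space3
  axis : Space3
  weight : Fin 4 → ℝ
  weight_pos : ∀ i, 0 < weight i
  weight_add : ∀ i, weight i + weight (i + 2) = 1
  axis_eq : ∀ i, axis = weight i • Q.edge i + weight (i + 2) • Q.edge (i + 2)
  height_edge : ∀ i, height (Q.edge i) = 1
  side_edge_self : ∀ i, side i (Q.edge i) = 1
  side_edge_add_one : ∀ i, side i (Q.edge (i + 1)) = 0
  side_add_two : ∀ i x, side (i + 2) x = -(weight (i + 2) / weight i * side i x)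
  eq_zero_of_coords : ∀ x, side 0 x = 0 → side 1 x = 0 → height x = 0 → x = 0

theorem exists_diagonal_crossing (Q : QuadPyramid) : ∃ (axis : Space3) (w : Fin 4 → ℝ),
    (∀ i, 0 < w i) ∧ (∀ i, w i + w (i + 2) = 1) ∧
      ∀ i, axis = w i • Q.edge i + w (i + 2) • Q.edge (i + 2) := by
  obtain ⟨X, ⟨w₀, w₂, hw₀, hw₂, hw₀₂, hX⟩, w₁, w₃, hw₁, hw₃, hw₁₃, hX'⟩ := Q.diagonals_cross
  set w := ![w₀, w₁, w₂, w₃]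
  have hw_add (i : Fin 4) : w i + w (i + 2) = 1 := by
    fin_cases i
    exacts [hw₀₂, hw₁₃, add_comm w₂ w₀ ▸ hw₀₂, add_comm w₃ w₁ ▸ hw₁₃]
  refine ⟨X - Q.apex, w, fun i => ?_, hw_add, fun i => ?_⟩
  · fin_cases i
    exacts [hw₀, hw₁, hw₂, hw₃]
  · rw [edge, edge, ← smul_add_smul_sub_of_add_eq_one (hw_add i)]
    refine congrArg (· - Q.apex) ?_
    fin_cases i
    exacts [hX.symm, hX'.symm, hX.symm.trans (add_comm _ _), hX'.symm.trans (add_comm _ _)]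

theorem exists_diagonal_coordinates (Q : QuadPyramid) :
    ∃ (coord : Fin 3 → StrongDual ℝ Space3) (axis : Space3) (w : Fin 4 → ℝ),
      (∀ x, (∀ j, coord j x = 0) → x = 0) ∧ (∀ i, 0 < w i) ∧ (∀ i, w i + w (i + 2) = 1) ∧
        (∀ i, axis = w i • Q.edge i + w (i + 2) • Q.edge (i + 2)) ∧
        (∀ j, coord j (Q.edge 0) = ![1, 0, 0] j) ∧ (∀ j, coord j (Q.edge 1) = ![0, 1, 0] j) ∧
        (∀ j, coord j (Q.edge 2) = ![0, 0, 1] j) ∧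
        ∀ j, coord j (Q.edge 3) = ![w 0 / w 3, -(w 1 / w 3), w 2 / w 3] j := by
  obtain ⟨coord, hcoord, eq_zero⟩ := Q.exists_edge_coordinates
  obtain ⟨axis, w, hw, hw_add, axis_eq⟩ := Q.exists_diagonal_crossing
  have edge_zero (j : Fin 3) : coord j (Q.edge 0) = ![1, 0, 0] j :=
    (hcoord j 0).trans (by fin_cases j <;> rfl)
  have edge_one (j : Fin 3) : coord j (Q.edge 1) = ![0, 1, 0] j :=
    (hcoord j 1).trans (by fin_cases j <;> rfl)
  have edge_two (j : Fin 3) : coord j (Q.edge 2) = ![0, 0, 1] j :=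
    (hcoord j 2).trans (by fin_cases j <;> rfl)
  have edge_three : Q.edge 3 = (w 3)⁻¹ • (w 0 • Q.edge 0 + w 2 • Q.edge 2 - w 1 • Q.edge 1) := by
    rw [eq_inv_smul_iff₀ (hw 3).ne', eq_sub_iff_add_eq']
    exact (axis_eq 1).symm.trans (axis_eq 0)
  refine ⟨coord, axis, w, eq_zero, hw, hw_add, axis_eq, edge_zero, edge_one, edge_two, fun j => ?_⟩
  fin_cases j <;> simp [edge_three, edge_zero, edge_one, edge_two, inv_mul_eq_div]

theorem nonempty_frame (Q : QuadPyramid) : Nonempty Q.Frame := by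
  obtain ⟨coord, axis, w, eq_zero, hw, hw_add, axis_eq, edge_zero, edge_one, edge_two,
    edge_three⟩ := Q.exists_diagonal_coordinates
  have hw₀ := hw 0
  have hw₁ := hw 1
  have hw₂ := hw 2
  have hw₃ := hw 3
  have hw₀₂ : w 0 + w 2 = 1 := hw_add 0
  have hw₁₃ : w 1 + w 3 = 1 := hw_add 1
  refine ⟨{
    height := coord 0 + coord 1 + coord 2
    side := ![coord 0 - (w 0 / w 2) • coord 2, coord 1, coord 2 - (w 2 / w 0) • coord 0,
      -(w 3 / w 1) • coord 1]
    axis, weight := w, weight_pos := hw, weight_add := hw_add, axis_eq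
    height_edge := fun i => ?_
    side_edge_self := fun i => ?_
    side_edge_add_one := fun i => ?_
    side_add_two := fun i x => ?_
    eq_zero_of_coords := fun x h₀ h₁ h => eq_zero x fun j => ?_ }⟩
  · have height_edge_three : (coord 0 + coord 1 + coord 2) (Q.edge 3) = 1 := by
      simp only [add_apply, edge_three, Matrix.cons_val]
      field_simp
      linarith
    fin_cases i
    on_goal 4 => exact height_edge_three
    all_goals simp [edge_zero, edge_one, edge_two]
  · fin_cases i <;> simp [edge_zero, edge_one, edge_two, edge_three, hw₁.ne', hw₃.ne']
  · have side_two_edge_three : (coord 2 - (w 2 / w 0) • coord 0) (Q.edge 3) = 0 := by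
      simp only [sub_apply, smul_apply, edge_three, Matrix.cons_val, smul_eq_mul]
      rw [div_mul_div_cancel₀ hw₀.ne', sub_self]
    fin_cases i
    on_goal 3 => exact side_two_edge_three
    all_goals simp [edge_zero, edge_one, edge_two]
  · fin_cases i <;>
      simp only [Fin.zero_eta, Fin.mk_one, Fin.reduceFinMk, Fin.reduceAdd, Matrix.cons_val,
        zero_add, sub_apply, smul_apply, smul_eq_mul] <;> field_simp <;> ring
  · simp only [Fin.isValue, Matrix.cons_val_zero, Matrix.cons_val_one, sub_apply, add_apply,
      smul_apply, smul_eq_mul] at h₀ h₁ h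
    have hpos : 0 < w 0 / w 2 + 1 := by positivity
    have h₂ : coord 2 x = 0 :=
      (mul_eq_zero.1 (by linarith : (w 0 / w 2 + 1) * coord 2 x = 0)).resolve_left hpos.ne'
    have h₀' : coord 0 x = 0 := by simpa [h₂] using h₀
    fin_cases j
    exacts [h₀', h₁, h₂]

namespace Frame

section Coordinates

variable (F : Q.Frame) (i : Fin 4) (x : Space3)

theorem height_axis : F.height F.axis = 1 := by
  rw [F.axis_eq 0, map_add, map_smul, map_smul, F.height_edge, F.height_edge, smul_eq_mul,
    smul_eq_mul, mul_one, mul_one, F.weight_add]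

theorem apex_add_axis_mem_segment : Q.apex + F.axis ∈ segment ℝ (Q.base i) (Q.base (i + 2)) := by
  refine ⟨F.weight i, F.weight (i + 2), (F.weight_pos i).le, (F.weight_pos _).le, F.weight_add i,
    sub_eq_iff_eq_add'.1 ?_⟩
  rw [smul_add_smul_sub_of_add_eq_one (F.weight_add i)]
  exact (F.axis_eq i).symm

theorem weight_ratio_pos : 0 < F.weight (i + 2) / F.weight i :=
  div_pos (F.weight_pos _) (F.weight_pos i)

theorem side_add_two_nonneg_iff : 0 ≤ F.side (i + 2) x ↔ F.side i x ≤ 0 := by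
  rw [F.side_add_two, ← mul_neg, mul_nonneg_iff_of_pos_left (F.weight_ratio_pos i), neg_nonneg]

theorem side_add_two_pos_iff : 0 < F.side (i + 2) x ↔ F.side i x < 0 := by
  rw [F.side_add_two, ← mul_neg, mul_pos_iff_of_pos_left (F.weight_ratio_pos i), neg_pos]

theorem side_add_two_neg_iff : F.side (i + 2) x < 0 ↔ 0 < F.side i x := by
  simpa only [not_le] using (F.side_add_two_nonneg_iff i x).not

variable {i x} in
theorem side_nonneg_of_side_add_two_le (h : F.side (i + 2) x ≤ F.side i x) : 0 ≤ F.side i x := by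
  by_contra! hneg
  exact (((F.side_add_two_pos_iff i x).2 hneg).trans_le h).not_gt hneg

theorem side_edge_add_three : F.side i (Q.edge (i + 3)) = 0 := by
  have h := F.side_add_two (i + 2) (Q.edge (i + 2 + 1))
  rwa [F.side_edge_add_one, mul_zero, neg_zero, show i + 2 + 2 = i by omega,
    show i + 2 + 1 = i + 3 by omega] at h

theorem side_add_one_edge : F.side (i + 1) (Q.edge i) = 0 := by
  simpa only [show i + 1 + 3 = i by omega] using F.side_edge_add_three (i + 1)

theorem side_axis : F.side i F.axis = 0 := by
  rw [F.axis_eq (i + 1), show i + 1 + 2 = i + 3 by omega, map_add, map_smul, map_smul,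
    F.side_edge_add_one, F.side_edge_add_three, smul_zero, smul_zero, add_zero]

theorem side_edge_add_two_neg : F.side i (Q.edge (i + 2)) < 0 := by
  rw [← F.side_add_two_pos_iff, F.side_edge_self]
  exact one_pos

variable {x} in
theorem eq_zero_of_consecutive_coords (h₀ : F.side i x = 0) (h₁ : F.side (i + 1) x = 0)
    (h : F.height x = 0) : x = 0 := by
  have side_add_two_eq_zero (j : Fin 4) (hj : F.side j x = 0) : F.side (j + 2) x = 0 := by
    rw [F.side_add_two, hj, mul_zero, neg_zero]
  have h₂ := side_add_two_eq_zero _ h₀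
  have h₃ := side_add_two_eq_zero _ h₁
  refine F.eq_zero_of_coords x ?_ ?_ h <;> fin_cases i <;> assumption

theorem eq_combination : x = F.side i x • Q.edge i + F.side (i + 1) x • Q.edge (i + 1) +
    (F.height x - F.side i x - F.side (i + 1) x) • F.axis := by
  refine sub_eq_zero.1 (F.eq_zero_of_consecutive_coords i ?_ ?_ ?_) <;>
    simp only [map_sub, map_add, map_smul, smul_eq_mul, F.side_edge_self, F.side_edge_add_one,
      F.side_add_one_edge, F.side_axis, F.height_edge, F.height_axis] <;> ring

theorem exists_side_nonneg : ∃ i, 0 ≤ F.side i x ∧ 0 ≤ F.side (i + 1) x := by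
  have h₂ := F.side_add_two_nonneg_iff 0 x
  have h₃ := F.side_add_two_nonneg_iff 1 x
  obtain h₀ | h₀ := le_total 0 (F.side 0 x) <;> obtain h₁ | h₁ := le_total 0 (F.side 1 x)
  exacts [⟨0, h₀, h₁⟩, ⟨3, h₃.2 h₁, h₀⟩, ⟨1, h₁, h₂.2 h₀⟩, ⟨2, h₂.2 h₀, h₃.2 h₁⟩]

end Coordinates

end Frame

theorem base_eq_apex_add_edge (Q : QuadPyramid) (i : Fin 4) : Q.base i = Q.apex + Q.edge i :=
  (add_sub_cancel _ _).symm

theorem isBounded_solid (Q : QuadPyramid) : Bornology.IsBounded Q.solid :=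
  isBounded_convexHull.2 ((Set.finite_range _).insert _).isBounded

theorem le_of_apex_add_mem_solid {u : Space3} (hu : Q.apex + u ∈ Q.solid) (φ : StrongDual ℝ Space3)
    {r : ℝ} (hr : 0 ≤ r) (hφ : ∀ i, φ (Q.edge i) ≤ r) : φ u ≤ r := by
  have hsolid : Q.solid ⊆ {x | φ x ≤ φ Q.apex + r} := by
    refine convexHull_min (Set.insert_subset_iff.2 ⟨?_, ?_⟩) (convex_halfSpace_le φ.isLinear _)
    · exact le_add_of_nonneg_right hr
    · rintro _ ⟨i, rfl⟩
      rw [Set.mem_ofPred_eq, base_eq_apex_add_edge, map_add]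
      exact add_le_add_right (hφ i) _
  simpa using hsolid hu

namespace Frame

variable (F : Q.Frame)

theorem apex_add_combination_mem_solid (i : Fin 4) {α β γ : ℝ} (hα : 0 ≤ α) (hβ : 0 ≤ β)
    (hγ : 0 ≤ γ) (hsum : α + β + γ ≤ 1) :
    Q.apex + (α • Q.edge i + β • Q.edge (i + 1) + γ • F.axis) ∈ Q.solid := by
  have hconvex : Convex ℝ Q.solid := convex_convexHull ℝ _
  have apex_mem : Q.apex ∈ Q.solid := subset_convexHull ℝ _ (Set.mem_insert _ _)
  have base_mem (j : Fin 4) : Q.base j ∈ Q.solid :=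
    subset_convexHull ℝ _ (Set.mem_insert_of_mem _ (Set.mem_range_self j))
  have axis_mem : Q.apex + F.axis ∈ Q.solid :=
    hconvex.segment_subset (base_mem _) (base_mem _) (F.apex_add_axis_mem_segment 0)
  have hmem := hconvex.sum_mem (t := Finset.univ) (w := ![1 - α - β - γ, α, β, γ])
    (z := ![Q.apex, Q.base i, Q.base (i + 1), Q.apex + F.axis])
    (by simpa [Fin.forall_fin_succ, hα, hβ, hγ] using by linarith)
    (by simp only [Fin.sum_univ_four, Matrix.cons_val]; ring)
    (by simp [Fin.forall_fin_succ, apex_mem, base_mem, axis_mem])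
  convert hmem using 1
  simp only [Fin.sum_univ_four, Matrix.cons_val, base_eq_apex_add_edge]
  module

theorem apex_add_mem_solid_iff {u : Space3} : Q.apex + u ∈ Q.solid ↔
    F.height u ≤ 1 ∧ ∀ i, F.side i u + F.side (i + 1) u ≤ F.height u := by
  constructor
  · refine fun hu => ⟨le_of_apex_add_mem_solid hu _ zero_le_one fun j => (F.height_edge j).le,
      fun i => ?_⟩
    refine sub_nonpos.1
      (le_of_apex_add_mem_solid hu (F.side i + F.side (i + 1) - F.height) le_rfl fun j => ?_)
    simp only [sub_apply, add_apply, F.height_edge]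
    obtain rfl | rfl | rfl | rfl : j = i ∨ j = i + 1 ∨ j = i + 2 ∨ j = i + 3 := by omega
    · linarith [F.side_edge_self j, F.side_add_one_edge j]
    · linarith [F.side_edge_self (i + 1), F.side_edge_add_one i]
    · have h := F.side_edge_add_one (i + 1)
      rw [show i + 1 + 1 = i + 2 by omega] at h
      linarith [F.side_edge_add_two_neg i]
    · have h := F.side_edge_add_two_neg (i + 1)
      rw [show i + 1 + 2 = i + 3 by omega] at h
      linarith [F.side_edge_add_three i]
  · rintro ⟨hheight, hlateral⟩
    obtain ⟨i, h₀, h₁⟩ := F.exists_side_nonneg u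
    rw [F.eq_combination i u]
    exact F.apex_add_combination_mem_solid i h₀ h₁ (by linarith [hlateral i]) (by linarith)

section CuttingPlanes

theorem vectorSpan_base : vectorSpan ℝ (Set.range Q.base) = F.height.ker := by
  refine le_antisymm ?_ fun x hx => ?_
  · rw [vectorSpan_range_eq_span_range_vsub_right ℝ _ 0, Submodule.span_le]
    rintro _ ⟨i, rfl⟩
    simp [base_eq_apex_add_edge, F.height_edge]
  · have base_mem (i : Fin 4) : Q.base i ∈ affineSpan ℝ (Set.range Q.base) :=
      mem_affineSpan ℝ (Set.mem_range_self i)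
    have axis_mem : Q.apex + F.axis ∈ affineSpan ℝ (Set.range Q.base) :=
      (affineSpan ℝ _).convex.segment_subset (base_mem _) (base_mem _)
        (F.apex_add_axis_mem_segment 0)
    have hsub (i : Fin 4) :
        Q.base i - (Q.apex + F.axis) ∈ vectorSpan ℝ (Set.range Q.base) := by
      rw [← direction_affineSpan]
      exact AffineSubspace.vsub_mem_direction (base_mem i) axis_mem
    have hx' := F.eq_combination 0 x
    rw [show F.height x = 0 from hx] at hx'
    convert add_mem (Submodule.smul_mem _ (F.side 0 x) (hsub 0))
      (Submodule.smul_mem _ (F.side 1 x) (hsub 1)) using 1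
    rw [base_eq_apex_add_edge, base_eq_apex_add_edge]
    refine hx'.trans ?_
    rw [zero_add]
    module

theorem vectorSpan_path (i : Fin 4) :
    vectorSpan ℝ {Q.base (i + 1), Q.apex, Q.base (i + 3)} = (F.side i).ker := by
  refine le_antisymm ?_ fun x hx => ?_
  · rw [vectorSpan_eq_span_vsub_set_right ℝ (p := Q.apex) (by simp), Submodule.span_le]
    simp [Set.insert_subset_iff, base_eq_apex_add_edge, F.side_edge_add_one,
      F.side_edge_add_three, Set.image_insert_eq]
  · set s : Set Space3 := {Q.base (i + 1), Q.apex, Q.base (i + 3)}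
    have apex_mem : Q.apex ∈ affineSpan ℝ s := mem_affineSpan ℝ (by simp [s])
    have base_mem : Q.base (i + 1) ∈ affineSpan ℝ s := mem_affineSpan ℝ (by simp [s])
    have base_mem' : Q.base (i + 1 + 2) ∈ affineSpan ℝ s :=
      mem_affineSpan ℝ (by simp [s, show i + 1 + 2 = i + 3 by omega])
    have axis_mem : Q.apex + F.axis ∈ affineSpan ℝ s :=
      (affineSpan ℝ _).convex.segment_subset base_mem base_mem' (F.apex_add_axis_mem_segment _)
    have hedge := AffineSubspace.vsub_mem_direction base_mem apex_mem
    have haxis := AffineSubspace.vsub_mem_direction axis_mem apex_mem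
    rw [vsub_eq_sub, add_sub_cancel_left] at haxis
    rw [F.eq_combination i x, show F.side i x = 0 from hx, zero_smul, zero_add,
      ← direction_affineSpan]
    exact add_mem (Submodule.smul_mem _ _ hedge) (Submodule.smul_mem _ _ haxis)

variable {p x : Space3}

theorem mem_topPlane_iff : x ∈ Q.topPlane p ↔ F.height x = F.height p := by
  simp [topPlane, F.vectorSpan_base, AffineSubspace.mem_mk', sub_eq_zero]

theorem mem_sidePlane_iff {i : Fin 4} : x ∈ Q.sidePlane i p ↔ F.side i x = F.side i p := by
  simp [sidePlane, F.vectorSpan_path, AffineSubspace.mem_mk', sub_eq_zero]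

theorem topPlane_wSameSide_iff {a : Space3} (h : F.height p < F.height a) :
    (Q.topPlane p).WSameSide a x ↔ F.height p ≤ F.height x := by
  rw [topPlane, F.vectorSpan_base]
  exact wSameSide_mk'_ker_iff F.height.toLinearMap h x

theorem sidePlane_wSameSide_iff {i : Fin 4} {a : Space3} (h : F.side i a < F.side i p) :
    (Q.sidePlane i p).WSameSide a x ↔ F.side i x ≤ F.side i p := by
  have hker : (F.side i).ker = (-(F.side i).toLinearMap).ker := by ext; simp
  rw [sidePlane, F.vectorSpan_path, hker, wSameSide_mk'_ker_iff _ (neg_lt_neg h)]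
  exact neg_le_neg_iff

end CuttingPlanes

end Frame
/-- The positions of the cuts along the lateral edges, as fractions of the edges measured from the
apex. The last three inequalities say that no two cuts meet in the pyramid and that no side cut
passes through a base vertex. -/
structure CutPositions where
  top : ℝ
  side : Fin 4 → ℝ
  top_pos : 0 < top
  top_lt_side : ∀ i, top < side i
  side_lt_one : ∀ i, side i < 1
  one_lt_side_add : ∀ i, 1 < side i + side (i + 1)

theorem CutPositions.side_pos (p : CutPositions) (i : Fin 4) : 0 < p.side i :=
  p.top_pos.trans (p.top_lt_side i)

theorem exists_eq_apex_add_smul_edge {x : Space3} {i : Fin 4}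
    (hx : x ∈ openSegment ℝ Q.apex (Q.base i)) :
    ∃ t : ℝ, 0 < t ∧ t < 1 ∧ x = Q.apex + t • Q.edge i := by
  rw [openSegment_eq_image'] at hx
  obtain ⟨t, ht, rfl⟩ := hx
  exact ⟨t, ht.1, ht.2, rfl⟩

namespace Cuts

theorem exists_cutPositions (c : Q.Cuts) : ∃ p : CutPositions,
    c.top = Q.apex + p.top • Q.edge 0 ∧ ∀ i, c.side i = Q.apex + p.side i • Q.edge i := by
  obtain ⟨F⟩ := Q.nonempty_frame
  obtain ⟨t, ht_pos, ht_lt, htop⟩ := exists_eq_apex_add_smul_edge c.top_mem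
  choose s hs_pos hs_lt hside using fun i => exists_eq_apex_add_smul_edge (c.side_mem i)
  have mem_topPlane {u : Space3} : Q.apex + u ∈ Q.topPlane c.top ↔ F.height u = t := by
    simp [F.mem_topPlane_iff, htop, F.height_edge]
  have mem_sidePlane {i : Fin 4} {u : Space3} :
      Q.apex + u ∈ Q.sidePlane i (c.side i) ↔ F.side i u = s i := by
    simp [F.mem_sidePlane_iff, hside, F.side_edge_self]
  refine ⟨⟨t, s, ht_pos, fun i => ?_, hs_lt, fun i => ?_⟩, htop, hside⟩ <;> by_contra! hle
  · have hsolid := F.apex_add_combination_mem_solid i (β := 0) (hs_pos i).le le_rfl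
      (sub_nonneg.2 hle) (by linarith)
    refine (c.top_disjoint i).le_bot ⟨⟨hsolid, mem_topPlane.2 ?_⟩, hsolid, mem_sidePlane.2 ?_⟩ <;>
      simp [F.height_edge, F.height_axis, F.side_edge_self, F.side_axis]
  · have hsolid := F.apex_add_combination_mem_solid i (hs_pos i).le (hs_pos (i + 1)).le
      (sub_nonneg.2 hle) (by linarith)
    refine (c.side_disjoint i (i + 1) (by simp)).le_bot
      ⟨⟨hsolid, mem_sidePlane.2 ?_⟩, hsolid, mem_sidePlane.2 ?_⟩ <;>
      simp [F.side_edge_self, F.side_edge_add_one, F.side_add_one_edge, F.side_axis]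

end Cuts

namespace Frame

open EquitruncatedFacet EquitruncatedVertex

variable (F : Q.Frame) (p : CutPositions)

/-- The ten inequalities that cut out an equitruncated pyramid, with its facets as labels. -/
def truncation : HalfspaceSystem EquitruncatedFacet Space3 where
  normal
    | top => -F.height
    | bottom => F.height
    | cut i => F.side i
    | lateral i => F.side i + F.side (i + 1) - F.height
  bound
    | top => -(F.height Q.apex + p.top)
    | bottom => F.height Q.apex + 1
    | cut i => F.side i Q.apex + p.side i
    | lateral i => F.side i Q.apex + F.side (i + 1) Q.apex - F.height Q.apex

variable {F p} {u v : Space3} {i : Fin 4}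

theorem apex_add_mem_truncation_iff : Q.apex + u ∈ (F.truncation p).carrier ↔
    (p.top ≤ F.height u ∧ F.height u ≤ 1) ∧ (∀ i, F.side i u ≤ p.side i) ∧
      ∀ i, F.side i u + F.side (i + 1) u ≤ F.height u := by
  constructor
  · intro h
    have htop := h top
    have hbottom := h bottom
    have hcut i := h (cut i)
    have hlateral i := h (lateral i)
    simp only [truncation, neg_apply, sub_apply, add_apply, map_add] at htop hbottom hcut hlateral
    exact ⟨⟨by linarith, by linarith⟩, fun i => by linarith [hcut i],
      fun i => by linarith [hlateral i]⟩
  · rintro ⟨⟨htop, hbottom⟩, hcut, hlateral⟩ (_ | _ | i | i) <;>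
      simp only [truncation, neg_apply, sub_apply, add_apply, map_add]
    · linarith
    · linarith
    · linarith [hcut i]
    · linarith [hlateral i]

theorem top_mem_tight_iff : top ∈ (F.truncation p).tight (Q.apex + u) ↔ F.height u = p.top := by
  rw [HalfspaceSystem.mem_tight]
  simp only [truncation, neg_apply, map_add]
  constructor <;> intro h <;> linarith

theorem bottom_mem_tight_iff : bottom ∈ (F.truncation p).tight (Q.apex + u) ↔ F.height u = 1 := by
  rw [HalfspaceSystem.mem_tight]
  simp only [truncation, map_add, add_right_inj]

theorem cut_mem_tight_iff :
    cut i ∈ (F.truncation p).tight (Q.apex + u) ↔ F.side i u = p.side i := by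
  rw [HalfspaceSystem.mem_tight]
  simp only [truncation, map_add, add_right_inj]

theorem lateral_mem_tight_iff : lateral i ∈ (F.truncation p).tight (Q.apex + u) ↔
    F.side i u + F.side (i + 1) u = F.height u := by
  simp only [HalfspaceSystem.mem_tight, truncation, sub_apply, add_apply, map_add]
  constructor <;> intro h <;> linarith

theorem equitruncated_eq_carrier (c : Q.Cuts) (htop : c.top = Q.apex + p.top • Q.edge 0)
    (hside : ∀ i, c.side i = Q.apex + p.side i • Q.edge i) :
    c.equitruncated = (F.truncation p).carrier := by
  have height_top : F.height c.top = F.height Q.apex + p.top := by simp [htop, F.height_edge]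
  have side_side (i : Fin 4) : F.side i (c.side i) = F.side i Q.apex + p.side i := by
    simp [hside, F.side_edge_self]
  have top_lt : F.height c.top < F.height (Q.base 0) := by
    rw [height_top, base_eq_apex_add_edge, map_add, F.height_edge]
    linarith [p.top_lt_side 0, p.side_lt_one 0]
  have lt_side (i : Fin 4) : F.side i Q.apex < F.side i (c.side i) := by
    linarith [side_side i, p.top_lt_side i, p.top_pos]
  ext x
  obtain ⟨u, rfl⟩ : ∃ u, x = Q.apex + u := ⟨x - Q.apex, by simp⟩
  rw [Cuts.equitruncated, Set.mem_ofPred_eq, F.apex_add_mem_solid_iff,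
    F.topPlane_wSameSide_iff top_lt, apex_add_mem_truncation_iff]
  simp only [F.sidePlane_wSameSide_iff (lt_side _), height_top, side_side, map_add,
    add_le_add_iff_left]
  tauto

section TightConstraints

variable (hu : Q.apex + u ∈ (F.truncation p).carrier)
include hu

theorem side_le_height (i : Fin 4) : F.side i u ≤ F.height u := by
  obtain ⟨-, -, hlateral⟩ := apex_add_mem_truncation_iff.1 hu
  have hnext := hlateral i
  have hprev := hlateral (i + 3)
  rw [show i + 3 + 1 = i by omega] at hprev
  obtain h | h := le_total 0 (F.side (i + 1) u)
  · linarith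
  · have := (F.side_add_two_nonneg_iff (i + 1) u).2 h
    rw [show i + 1 + 2 = i + 3 by omega] at this
    linarith

theorem side_nonneg_of_lateral_mem_tight
    (hi : lateral i ∈ (F.truncation p).tight (Q.apex + u)) :
    0 ≤ F.side i u ∧ 0 ≤ F.side (i + 1) u := by
  obtain ⟨-, -, hlateral⟩ := apex_add_mem_truncation_iff.1 hu
  rw [lateral_mem_tight_iff] at hi
  have hnext := hlateral (i + 1)
  have hprev := hlateral (i + 3)
  rw [show i + 1 + 1 = i + 2 by omega] at hnext
  rw [show i + 3 + 1 = i by omega, show i + 3 = i + 1 + 2 by omega] at hprev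
  exact ⟨F.side_nonneg_of_side_add_two_le (by linarith),
    F.side_nonneg_of_side_add_two_le (by linarith)⟩

theorem cut_notMem_tight_of_top (h : top ∈ (F.truncation p).tight (Q.apex + u)) :
    cut i ∉ (F.truncation p).tight (Q.apex + u) := by
  rw [top_mem_tight_iff] at h
  rw [cut_mem_tight_iff]
  linarith [p.top_lt_side i, side_le_height hu i]

theorem cut_notMem_tight_of_cut (h : cut i ∈ (F.truncation p).tight (Q.apex + u)) :
    cut (i + 1) ∉ (F.truncation p).tight (Q.apex + u) ∧
      cut (i + 2) ∉ (F.truncation p).tight (Q.apex + u) := by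
  obtain ⟨⟨-, hheight⟩, -, hlateral⟩ := apex_add_mem_truncation_iff.1 hu
  rw [cut_mem_tight_iff] at h
  have hpos : 0 < F.side i u := h ▸ p.side_pos i
  have hneg := (F.side_add_two_neg_iff i u).2 hpos
  rw [cut_mem_tight_iff, cut_mem_tight_iff]
  exact ⟨by linarith [hlateral i, p.one_lt_side_add i], (hneg.trans (p.side_pos _)).ne⟩

theorem lateral_notMem_tight_of_cut (h : cut i ∈ (F.truncation p).tight (Q.apex + u)) :
    lateral (i + 1) ∉ (F.truncation p).tight (Q.apex + u) ∧
      lateral (i + 2) ∉ (F.truncation p).tight (Q.apex + u) := by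
  rw [cut_mem_tight_iff] at h
  have hpos : 0 < F.side i u := h ▸ p.side_pos i
  have hneg := (F.side_add_two_neg_iff i u).2 hpos
  constructor <;> intro hlateral
  · have hnonneg := (side_nonneg_of_lateral_mem_tight hu hlateral).2
    rw [show i + 1 + 1 = i + 2 by omega] at hnonneg
    exact hneg.not_ge hnonneg
  · exact hneg.not_ge (side_nonneg_of_lateral_mem_tight hu hlateral).1

theorem lateral_notMem_tight_of_lateral
    (h : lateral i ∈ (F.truncation p).tight (Q.apex + u)) :
    lateral (i + 2) ∉ (F.truncation p).tight (Q.apex + u) := by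
  intro h'
  obtain ⟨⟨hheight, -⟩, -⟩ := apex_add_mem_truncation_iff.1 hu
  obtain ⟨hi, hi'⟩ := side_nonneg_of_lateral_mem_tight hu h'
  rw [F.side_add_two_nonneg_iff] at hi
  rw [show i + 2 + 1 = i + 1 + 2 by omega, F.side_add_two_nonneg_iff] at hi'
  rw [lateral_mem_tight_iff] at h
  linarith [p.top_pos]

theorem lateral_notMem_tight_of_bottom
    (h : bottom ∈ (F.truncation p).tight (Q.apex + u))
    (hi : lateral i ∈ (F.truncation p).tight (Q.apex + u)) :
    lateral (i + 1) ∉ (F.truncation p).tight (Q.apex + u) := by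
  intro hi'
  obtain ⟨-, hcut, -⟩ := apex_add_mem_truncation_iff.1 hu
  have hnonneg := (side_nonneg_of_lateral_mem_tight hu hi').2
  rw [show i + 1 + 1 = i + 2 by omega, F.side_add_two_nonneg_iff] at hnonneg
  rw [bottom_mem_tight_iff] at h
  rw [lateral_mem_tight_iff] at hi
  linarith [hcut (i + 1), p.side_lt_one (i + 1)]

end TightConstraints

theorem bottom_notMem_tight_of_top (h : top ∈ (F.truncation p).tight (Q.apex + u)) :
    bottom ∉ (F.truncation p).tight (Q.apex + u) := by
  rw [top_mem_tight_iff] at h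
  rw [bottom_mem_tight_iff]
  linarith [p.top_lt_side 0, p.side_lt_one 0]

section Vertices

variable (F) (i) (α β : ℝ)

theorem height_edge_combination : F.height (α • Q.edge i + β • Q.edge (i + 1)) = α + β := by
  simp [F.height_edge]

theorem side_edge_combination : F.side i (α • Q.edge i + β • Q.edge (i + 1)) = α := by
  simp [F.side_edge_self, F.side_edge_add_one]

theorem side_add_one_edge_combination :
    F.side (i + 1) (α • Q.edge i + β • Q.edge (i + 1)) = β := by
  simp [F.side_edge_self, F.side_add_one_edge]

variable {F i α β}

theorem edge_combination_mem_carrier (hα : α ∈ Set.Icc 0 (p.side i))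
    (hβ : β ∈ Set.Icc 0 (p.side (i + 1))) (hsum : α + β ∈ Set.Icc p.top 1) :
    Q.apex + (α • Q.edge i + β • Q.edge (i + 1)) ∈ (F.truncation p).carrier := by
  have hheight := F.height_edge_combination i α β
  have hsolid := F.apex_add_combination_mem_solid i hα.1 hβ.1 le_rfl (by linarith [hsum.2])
  rw [zero_smul, add_zero, F.apex_add_mem_solid_iff] at hsolid
  refine apex_add_mem_truncation_iff.2 ⟨⟨hheight ▸ hsum.1, hsolid.1⟩, fun j => ?_, hsolid.2⟩
  have side_add_two_le {k : Fin 4} {u : Space3} (h : 0 ≤ F.side k u) :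
      F.side (k + 2) u ≤ p.side (k + 2) := by
    rw [← not_lt, ← F.side_add_two_pos_iff, not_lt] at h
    exact h.trans (p.side_pos _).le
  obtain rfl | rfl | rfl | rfl : j = i ∨ j = i + 1 ∨ j = i + 2 ∨ j = i + 1 + 2 := by omega
  · rw [F.side_edge_combination]
    exact hα.2
  · rw [F.side_add_one_edge_combination]
    exact hβ.2
  · refine side_add_two_le ?_
    rw [F.side_edge_combination]
    exact hα.1
  · refine side_add_two_le ?_
    rw [F.side_add_one_edge_combination]
    exact hβ.1

variable (F p i α β) in
theorem lateral_mem_tight_edge_combination :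
    lateral i ∈ (F.truncation p).tight (Q.apex + (α • Q.edge i + β • Q.edge (i + 1))) := by
  rw [lateral_mem_tight_iff, F.side_edge_combination, F.side_add_one_edge_combination,
    F.height_edge_combination]

variable (F p i α) in
theorem lateral_add_three_mem_tight_edge_combination : lateral (i + 3) ∈
    (F.truncation p).tight (Q.apex + (α • Q.edge i + (0 : ℝ) • Q.edge (i + 1))) := by
  have hpoint : α • Q.edge i + (0 : ℝ) • Q.edge (i + 1) =
      (0 : ℝ) • Q.edge (i + 3) + α • Q.edge (i + 3 + 1) := by
    rw [show i + 3 + 1 = i by omega, zero_smul, zero_smul, add_comm]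
  rw [hpoint]
  exact F.lateral_mem_tight_edge_combination p (i + 3) 0 α

theorem lateral_edge_mem_carrier (hα : α ∈ Set.Icc p.top (p.side i)) :
    Q.apex + (α • Q.edge i + (0 : ℝ) • Q.edge (i + 1)) ∈ (F.truncation p).carrier := by
  refine edge_combination_mem_carrier ⟨p.top_pos.le.trans hα.1, hα.2⟩
    ⟨le_rfl, (p.side_pos _).le⟩ ?_
  rw [add_zero]
  exact ⟨hα.1, hα.2.trans (p.side_lt_one i).le⟩

theorem base_edge_mem_carrier (hα : α ≤ p.side i) (hβ : β ≤ p.side (i + 1)) (hsum : α + β = 1) :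
    Q.apex + (α • Q.edge i + β • Q.edge (i + 1)) ∈ (F.truncation p).carrier := by
  have hα' := hα.trans_lt (p.side_lt_one i)
  have hβ' := hβ.trans_lt (p.side_lt_one (i + 1))
  refine edge_combination_mem_carrier ⟨by linarith, hα⟩ ⟨by linarith, hβ⟩ ?_
  rw [hsum]
  exact ⟨((p.top_lt_side 0).trans (p.side_lt_one 0)).le, le_rfl⟩

theorem exists_facets_subset_tight (w : EquitruncatedVertex) :
    ∃ x ∈ (F.truncation p).carrier, facets w ⊆ (F.truncation p).tight x := by
  have triple_subset {a b c : EquitruncatedFacet} {T : Finset EquitruncatedFacet} (ha : a ∈ T)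
      (hb : b ∈ T) (hc : c ∈ T) : {a, b, c} ⊆ T := by
    simp only [Finset.insert_subset_iff, Finset.singleton_subset_iff, ha, hb, hc, and_self]
  rcases w with i | i | i | i
  · refine ⟨_, lateral_edge_mem_carrier ⟨le_rfl, (p.top_lt_side i).le⟩,
      triple_subset (top_mem_tight_iff.2 ?_) (F.lateral_mem_tight_edge_combination p i _ _)
        (F.lateral_add_three_mem_tight_edge_combination p i _)⟩
    rw [F.height_edge_combination, add_zero]
  · exact ⟨_, lateral_edge_mem_carrier ⟨(p.top_lt_side i).le, le_rfl⟩,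
      triple_subset (cut_mem_tight_iff.2 (F.side_edge_combination i _ _))
        (F.lateral_mem_tight_edge_combination p i _ _)
        (F.lateral_add_three_mem_tight_edge_combination p i _)⟩
  · have hsum : p.side i + (1 - p.side i) = 1 := add_sub_cancel _ _
    exact ⟨_, base_edge_mem_carrier le_rfl (by linarith [p.one_lt_side_add i]) hsum,
      triple_subset (bottom_mem_tight_iff.2 ((F.height_edge_combination i _ _).trans hsum))
        (cut_mem_tight_iff.2 (F.side_edge_combination i _ _))
        (F.lateral_mem_tight_edge_combination p i _ _)⟩
  · have hsum : 1 - p.side (i + 1) + p.side (i + 1) = 1 := sub_add_cancel _ _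
    exact ⟨_, base_edge_mem_carrier (by linarith [p.one_lt_side_add i]) le_rfl hsum,
      triple_subset (bottom_mem_tight_iff.2 ((F.height_edge_combination i _ _).trans hsum))
        (cut_mem_tight_iff.2 (F.side_add_one_edge_combination i _ _))
        (F.lateral_mem_tight_edge_combination p i _ _)⟩

theorem tight_image_extremePoints (hbounded : Bornology.IsBounded (F.truncation p).carrier) :
    (F.truncation p).tight '' (F.truncation p).carrier.extremePoints ℝ = Set.range facets := by
  have hcompact :=
    Metric.isCompact_of_isClosed_isBounded (F.truncation p).isClosed_carrier hbounded
  have hsub : (F.truncation p).tight '' (F.truncation p).carrier.extremePoints ℝ ⊆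
      Set.range facets := by
    rintro _ ⟨x, hx, rfl⟩
    have hcard := HalfspaceSystem.finrank_le_card_tight hx
    rw [finrank_euclideanSpace_fin] at hcard
    obtain ⟨u, rfl⟩ : ∃ u, x = Q.apex + u := ⟨x - Q.apex, by simp⟩
    exact exists_facets_eq hcard bottom_notMem_tight_of_top
      (fun i => cut_notMem_tight_of_top hx.1) (fun i => cut_notMem_tight_of_cut hx.1)
      (fun i => lateral_notMem_tight_of_cut hx.1) (fun i => lateral_notMem_tight_of_lateral hx.1)
      (fun i => lateral_notMem_tight_of_bottom hx.1)
  refine hsub.antisymm ?_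
  rintro _ ⟨w, rfl⟩
  obtain ⟨x, hx, hwx⟩ := exists_facets_subset_tight w
  obtain ⟨y, hy, hxy⟩ := HalfspaceSystem.exists_mem_extremePoints_tight_subset hcompact hx
  obtain ⟨w', hw'⟩ := hsub ⟨y, hy, rfl⟩
  refine ⟨y, hy, (Finset.eq_of_subset_of_card_le (hwx.trans hxy) ?_).symm⟩
  rw [← hw', card_facets, card_facets]

end Vertices

theorem ncard_facets_mixed_visible (hv : ∀ f, (F.truncation p).normal f v ≠ 0) :
    {w | (∃ f ∈ facets w, f ∈ (F.truncation p).visible v) ∧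
      ∃ f ∈ facets w, f ∉ (F.truncation p).visible v}.ncard = 10 := by
  have height_ne_zero : F.height v ≠ 0 := hv bottom
  have side_ne_zero (i : Fin 4) : F.side i v ≠ 0 := hv (cut i)
  have side_pos_iff (i : Fin 4) : 0 < F.side (i + 2) v ↔ ¬ 0 < F.side i v := by
    rw [F.side_add_two_pos_iff, not_lt, (side_ne_zero i).le_iff_lt]
  have top_iff : top ∈ (F.truncation p).visible v ↔ F.height v < 0 := by
    rw [HalfspaceSystem.mem_visible]
    exact neg_pos
  have bottom_iff : bottom ∈ (F.truncation p).visible v ↔ 0 < F.height v :=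
    HalfspaceSystem.mem_visible _
  have cut_iff (i : Fin 4) : cut i ∈ (F.truncation p).visible v ↔ 0 < F.side i v :=
    HalfspaceSystem.mem_visible _
  have lateral_iff (i : Fin 4) : lateral i ∈ (F.truncation p).visible v ↔
      F.height v < F.side i v + F.side (i + 1) v := by
    rw [HalfspaceSystem.mem_visible]
    exact sub_pos
  apply ncard_setOf_facets_mixed
  · rw [bottom_iff, top_iff, not_lt, height_ne_zero.symm.le_iff_lt]
  · simpa only [cut_iff] using side_pos_iff
  · intro i hi
    rw [cut_iff] at hi
    have hneg := (F.side_add_two_neg_iff i v).2 hi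
    simp only [lateral_iff, show i + 1 + 1 = i + 2 by omega, show i + 2 + 1 = i + 3 by omega,
      show i + 3 + 1 = i by omega]
    exact ⟨fun h => by linarith, fun h => by linarith⟩
  · intro i htop hi hi'
    rw [top_iff] at htop
    rw [cut_iff] at hi hi'
    rw [lateral_iff]
    linarith
  · intro i hbottom hi
    rw [bottom_iff] at hbottom
    rw [lateral_iff] at hi
    rw [cut_iff, cut_iff]
    by_contra! h
    linarith

end Frame

end QuadPyramid

theorem mainTheorem3 (Q : QuadPyramid) (c : Q.Cuts) : IsEquiprojective 10 c.equitruncated := by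
  obtain ⟨F⟩ := Q.nonempty_frame
  obtain ⟨p, htop, hside⟩ := c.exists_cutPositions
  have hcarrier : c.equitruncated = (F.truncation p).carrier :=
    QuadPyramid.Frame.equitruncated_eq_carrier c htop hside
  have hbounded : Bornology.IsBounded (F.truncation p).carrier :=
    hcarrier ▸ Q.isBounded_solid.subset (Set.sep_subset _ _)
  rw [hcarrier]
  exact HalfspaceSystem.isEquiprojective_carrier
    (QuadPyramid.Frame.tight_image_extremePoints hbounded)
    EquitruncatedVertex.exists_mem_facets_notMem_facets hbounded
    EquitruncatedVertex.facets_injective fun v hv =>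
      QuadPyramid.Frame.ncard_facets_mixed_visible hv
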